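/- Let $\mathfrak{L}^{w}$ be the set of linear differential behaviors with $w$ variables, i.e. the sets $\mathfrak{B}=\ker R(\tfrac{d}{dt})=\{v\in C^\infty(\mathbb{R},\mathbb{R}^{w}) : R(\tfrac{d}{dt})v=0\}$ with $R$ a real polynomial matrix with $w$ columns (a kernel representation of $\mathfrak{B}$). The input cardinality of $\mathfrak{B}$ is $m(\mathfrak{B})=w-\operatorname{rank}R$, where $\operatorname{rank}R$ is the rank of the polynomial matrix $R$ (it does not depend on the choice of $R$). $\mathfrak{B}$ is called controllable if for all $v_1,v_2\in\mathfrak{B}$ there are $v_3\in\mathfrak{B}$ and $\tau>0$ with $v_3(t)=v_1(t)$ for $t\le 0$ and $v_3(t)=v_2(t)$ for $t\ge\tau$. A smallest controllable superbehavior of $\mathfrak{B}_1\in\mathfrak{L}^{w}$ is a controllable $\mathfrak{B}_2\in\mathfrak{L}^{w}$ with $\mathfrak{B}_2\supseteq\mathfrak{B}_1$ whose input cardinality is least among all controllable behaviors in $\mathfrak{L}^{w}$ containing $\mathfrak{B}_1$. Theorem. Let $\mathfrak{B}_1\in\mathfrak{L}^{w}$ and let $R_1$ be a kernel representation of $\mathfrak{B}_1$.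 1. A smallest controllable superbehavior $\mathfrak{B}_2$ of $\mathfrak{B}_1$ exists. 2. $\mathfrak{B}_2$ is unique if and only if $\mathfrak{B}_1$ is controllable or $R_1(\lambda)=0$ for some $\lambda\in\mathbb{C}$. (In particular, if $R_1(\lambda)\neq 0$ for all $\lambda\in\mathbb{C}$, then $\mathfrak{B}_2$ is unique if and only if $\mathfrak{B}_1$ is controllable.) If $\mathfrak{B}_1$ is controllable, then $\mathfrak{B}_1$ itself is the only smallest controllable superbehavior of $\mathfrak{B}_1$. 3. If $\mathfrak{B}_1$ is uncontrollable, then every smallest controllable superbehavior $\mathfrak{B}_2$ of $\mathfrak{B}_1$ satisfies $m(\mathfrak{B}_2)>m(\mathfrak{B}_1)$, and more precisely $m(\mathfrak{B}_2)=m(\mathfrak{B}_1)+k$, where $k=\max_{\lambda\in\mathbb{C}}\operatorname{rank}R_1(\lambda)-\min_{\lambda\in\mathbb{C}}\operatorname{rank}R_1(\lambda)$. -/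

import Mathlib

open Polynomial
open scoped ContDiff

noncomputable section

/-- The scalar differential operator `p(d/dt)` with constant real coefficients. -/
def diffOp (p : ℝ[X]) (f : ℝ → ℝ) (t : ℝ) : ℝ :=
  p.sum fun n a => a * iteratedDeriv n f t

/-- The smooth solutions `w : ℝ → ℝ^w` of the system `R(d/dt) w = 0`. -/
def kerDiff {p w : ℕ} (R : Matrix (Fin p) (Fin w) ℝ[X]) : Set (ℝ → Fin w → ℝ) :=
  {f | ContDiff ℝ ∞ f ∧ ∀ (i : Fin p) (t : ℝ), ∑ j, diffOp (R i j) (fun s => f s j) t = 0}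

/-- Linear differential behaviors with `w` variables: the sets of smooth trajectories that are
the kernel of `R(d/dt)` for some real polynomial matrix `R` with `w` columns. -/
@[ext]
structure LinDiffBehavior (w : ℕ) where
  carrier : Set (ℝ → Fin w → ℝ)
  exists_ker : ∃ (p : ℕ) (R : Matrix (Fin p) (Fin w) ℝ[X]), carrier = kerDiff R

namespace LinDiffBehavior

variable {w : ℕ}

/-- `R` is a kernel representation of `B`. Rows of `R` may be redundant. -/
def IsKernelRep (B : LinDiffBehavior w) {p : ℕ} (R : Matrix (Fin p) (Fin w) ℝ[X]) : Prop :=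
  B.carrier = kerDiff R

/-- Input cardinality: `w - rank R`, where `R` is a kernel representation of `B` (the value does
not depend on which one). The rank over the domain `ℝ[X]` is the rank over its fraction field,
and it is at most `w`, so that the subtraction does not truncate. -/
def inputCard (B : LinDiffBehavior w) : ℕ :=
  w - B.exists_ker.choose_spec.choose.rank

/-- Controllability, as patchability of any two trajectories. -/
def Controllable (B : LinDiffBehavior w) : Prop :=
  ∀ w₁ ∈ B.carrier, ∀ w₂ ∈ B.carrier, ∃ w₃ ∈ B.carrier, ∃ τ : ℝ, 0 < τ ∧
    (∀ t ≤ 0, w₃ t = w₁ t) ∧ (∀ t, τ ≤ t → w₃ t = w₂ t)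

/-- `B₂` is a controllable superbehavior of `B₁`. -/
def IsControllableSuper (B₁ B₂ : LinDiffBehavior w) : Prop :=
  B₁.carrier ⊆ B₂.carrier ∧ B₂.Controllable

/-- `B₂` is a controllable superbehavior of `B₁` with the least input cardinality. -/
def IsSmallestControllableSuper (B₁ B₂ : LinDiffBehavior w) : Prop :=
  IsControllableSuper B₁ B₂ ∧
    ∀ B : LinDiffBehavior w, IsControllableSuper B₁ B → B₂.inputCard ≤ B.inputCard

end LinDiffBehavior

/-- The complex matrix `R(z)`. -/
def evalAt {p w : ℕ} (R : Matrix (Fin p) (Fin w) ℝ[X]) (z : ℂ) : Matrix (Fin p) (Fin w) ℂ :=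
  R.map (aeval z)

/-- `max_z rank R(z) - min_z rank R(z)` over all complex `z` (ranks lie between `0` and `w`, so
both extrema are attained). -/
def rankDrop {p w : ℕ} (R : Matrix (Fin p) (Fin w) ℝ[X]) : ℕ :=
  (⨆ z : ℂ, (evalAt R z).rank) - (⨅ z : ℂ, (evalAt R z).rank)

end

/-! Among the matrices `V` with rows in the row span of `R₁` and with a polynomial right inverse
`Φ`, choose one with the greatest number `s` of rows. Over the principal ideal domain `ℝ[X]`, a
suitable choice of `Φ` makes all entries of `T = R₁ - R₁ * Φ * V` share a divisor `d` that is not a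
unit (`exists_split_reduction`). At a complex root of `d`, `R₁(z)` factors through `V(z)` and has
rank at most `s`; since `V = L * R₁`, its rank is at least `s` everywhere. So `s` is the minimal
rank.

Controllability means `T = 0` (`controllable_iff`). If `T = 0`, then `R₁` and `V` have the same
kernel, and the projection `1 - Φ * V` onto it patches trajectories. If `T ≠ 0`, an exponential at a
root of `d` cannot be joined to zero, because a scalar equation with constant coefficients has
unique continuation. In particular the kernel matrices of a controllable behavior have constant
rank.

Testing an inclusion of behaviors on exponentials gives inequalities between ranks at each `z`.
Hence a controllable superbehavior has rank at most `s`, and `ker V` attains this bound. When `T ≠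
0` and `s > 0`, adding a row of `T` to a row of `V` gives a second minimizer. In the other cases
uniqueness follows because nested controllable behaviors of equal input cardinality coincide
(`eq_of_subset_of_controllable`). -/

noncomputable section

/-! ### Smooth functions as a module over `ℝ[X]` -/

/-- Smooth real functions on the line. -/
def SmoothFun : Submodule ℝ (ℝ → ℝ) where
  carrier := {f | ContDiff ℝ ∞ f}
  add_mem' {f g} (hf : ContDiff ℝ ∞ f) (hg : ContDiff ℝ ∞ g) := hf.add hg
  zero_mem' := (contDiff_const : ContDiff ℝ ∞ fun _ => (0 : ℝ))
  smul_mem' c f (hf : ContDiff ℝ ∞ f) := hf.const_smul c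

namespace SmoothFun

lemma contDiff (f : SmoothFun) : ContDiff ℝ ∞ f.1 := f.2

/-- Differentiation of smooth functions. -/
def D : SmoothFun →ₗ[ℝ] SmoothFun where
  toFun f := ⟨deriv f.1, (contDiff_infty_iff_deriv.1 f.2).2⟩
  map_add' f g := by
    ext t
    exact deriv_add ((contDiff_infty_iff_deriv.1 f.2).1 t) ((contDiff_infty_iff_deriv.1 g.2).1 t)
  map_smul' c f := by
    ext t
    exact deriv_const_smul c ((contDiff_infty_iff_deriv.1 f.2).1 t)

/-- A polynomial acts on smooth functions as a differential operator. -/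
instance : Module ℝ[X] SmoothFun :=
  Module.compHom SmoothFun (aeval D : ℝ[X] →ₐ[ℝ] Module.End ℝ SmoothFun).toRingHom

lemma smul_def (p : ℝ[X]) (f : SmoothFun) : p • f = aeval D p f := rfl

lemma X_smul (f : SmoothFun) : (X : ℝ[X]) • f = D f := by simp [smul_def]

lemma C_smul (a : ℝ) (f : SmoothFun) : (C a : ℝ[X]) • f = a • f := by
  simp [smul_def, Module.algebraMap_end_apply]

lemma coe_D_pow (n : ℕ) (f : SmoothFun) : ((D ^ n) f).1 = iteratedDeriv n f.1 := by
  induction n with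
  | zero => simp
  | succ n ih => rw [pow_succ', iteratedDeriv_succ, ← ih]; rfl

lemma smul_apply_eq_sum (p : ℝ[X]) (f : SmoothFun) (t : ℝ) :
    (p • f).1 t = p.sum fun n a => a * iteratedDeriv n f.1 t := by
  rw [smul_def, aeval_eq_sum_range, Polynomial.sum_over_range _ (by simp)]
  simp [coe_D_pow]

lemma smul_apply (p : ℝ[X]) (f : SmoothFun) (t : ℝ) : (p • f).1 t = diffOp p f.1 t :=
  smul_apply_eq_sum p f t

lemma smul_congr (p : ℝ[X]) {f g : SmoothFun} {t : ℝ} (h : f.1 =ᶠ[nhds t] g.1) :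
    (p • f).1 t = (p • g).1 t := by
  simp only [smul_apply_eq_sum, h.iteratedDeriv_eq]

/-- The real exponential trajectory `Re (c e^{zt})`. -/
def expRe (z : ℂ) : ℂ →ₗ[ℝ] SmoothFun where
  toFun c := ⟨fun t => (c * Complex.exp (z * t)).re, by
    have h : ContDiff ℝ ∞ fun t : ℝ => c * Complex.exp (z * t) :=
      contDiff_const.mul (contDiff_const.mul Complex.ofRealCLM.contDiff).cexp
    exact Complex.reCLM.contDiff.comp h⟩
  map_add' a b := by ext t; simp [add_mul]
  map_smul' a b := by ext t; simp [mul_assoc]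

lemma D_expRe (z c : ℂ) : D (expRe z c) = expRe z (z * c) := by
  ext t
  have h : HasDerivAt (fun t : ℝ => c * Complex.exp (z * t))
      (c * (Complex.exp (z * t) * (z * 1))) t :=
    (((hasDerivAt_id (t : ℂ)).const_mul z).cexp.const_mul c).comp_ofReal
  have h2 := (Complex.reCLM.hasFDerivAt.comp_hasDerivAt t h).deriv
  change deriv (fun t : ℝ => (c * Complex.exp (z * t)).re) t = (z * c * Complex.exp (z * t)).re
  rw [show z * c * Complex.exp (z * t) = c * (Complex.exp (z * t) * (z * 1)) by ring]
  exact h2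

lemma smul_expRe (p : ℝ[X]) (z c : ℂ) : p • expRe z c = expRe z (aeval z p * c) := by
  induction p using Polynomial.induction_on' with
  | add p q hp hq => rw [add_smul, hp, hq, map_add, add_mul, map_add]
  | monomial n a =>
    induction n with
    | zero =>
      rw [monomial_zero_left, C_smul, ← map_smul, aeval_C]
      simp
    | succ n ih =>
      rw [← X_mul_monomial, mul_smul, ih, X_smul, D_expRe, map_mul (aeval z), aeval_X, mul_assoc]

lemma expRe_apply_zero (z c : ℂ) : (expRe z c).1 0 = c.re := by simp [expRe]

/-- A solution of a scalar equation with constant coefficients that vanishes near a point is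
zero. -/
theorem eq_zero_of_smul_eq_zero {p : ℝ[X]} (hp : p ≠ 0) {g : SmoothFun} (h : p • g = 0)
    {t₀ : ℝ} (h0 : g.1 =ᶠ[nhds t₀] fun _ => 0) : g = 0 := by
  set n := p.natDegree with hn
  have hder : ∀ (i : ℕ) (t : ℝ),
      HasDerivAt (iteratedDeriv i g.1) (iteratedDeriv (i + 1) g.1 t) t := by
    intro i t
    rw [iteratedDeriv_succ, ← coe_D_pow]
    exact ((contDiff_infty_iff_deriv.1 ((D ^ i) g).2).1 t).hasDerivAt
  have hneg : ∀ i, iteratedDeriv i g.1 t₀ = 0 := by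
    intro i
    rw [h0.iteratedDeriv_eq]
    simp
  have htop : ∀ t, iteratedDeriv n g.1 t =
      ∑ j : Fin n, -(p.coeff j / p.leadingCoeff) * iteratedDeriv j g.1 t := by
    intro t
    have h1 : (p • g).1 t = 0 := by rw [h]; rfl
    rw [smul_apply_eq_sum, Polynomial.sum_over_range _ (by simp), Finset.sum_range_succ,
      ← hn, Finset.sum_range] at h1
    have hl : p.leadingCoeff ≠ 0 := leadingCoeff_ne_zero.2 hp
    have h2 : p.coeff n = p.leadingCoeff := rfl
    rw [h2] at h1
    have h3 : p.leadingCoeff * iteratedDeriv n g.1 t =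
        p.leadingCoeff * ∑ j : Fin n, -(p.coeff j / p.leadingCoeff) * iteratedDeriv j g.1 t := by
      rw [Finset.mul_sum, eq_neg_of_add_eq_zero_right h1, ← Finset.sum_neg_distrib]
      refine Finset.sum_congr rfl fun j _ => ?_
      field_simp
    exact mul_left_cancel₀ hl h3
  -- The companion map: the vector of derivatives of order below `n` solves `y' = A y` and vanishes
  -- at `t₀`, so uniqueness for Lipschitz equations applies.
  let A : (Fin n → ℝ) →ₗ[ℝ] (Fin n → ℝ) := LinearMap.pi fun i =>
    if hi : (i : ℕ) + 1 < n then LinearMap.proj ⟨i + 1, hi⟩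
    else ∑ j : Fin n, -(p.coeff j / p.leadingCoeff) • LinearMap.proj j
  have hA : ∀ t, A (fun i : Fin n => iteratedDeriv i g.1 t) =
      fun i : Fin n => iteratedDeriv (i + 1) g.1 t := by
    intro t
    ext i
    simp only [A, LinearMap.pi_apply]
    split_ifs with hi
    · rfl
    · have : (i : ℕ) + 1 = n := by omega
      rw [this, htop]
      simp
  have key : (fun (t : ℝ) (i : Fin n) => iteratedDeriv i g.1 t) = fun _ _ => 0 := by
    refine ODE_solution_unique_univ (v := fun _ => A) (s := fun _ => Set.univ) (t₀ := t₀)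
      (K := ‖LinearMap.toContinuousLinearMap A‖₊)
      (fun _ => (LinearMap.toContinuousLinearMap A).lipschitz.lipschitzOnWith)
      (fun t => ⟨?_, trivial⟩) (fun t => ⟨?_, trivial⟩) ?_
    · rw [hA, hasDerivAt_pi]
      exact fun i => hder i t
    · rw [show (fun _ : Fin n => (0 : ℝ)) = 0 from rfl, map_zero]
      exact hasDerivAt_const _ _
    · ext i
      exact hneg i
  ext t
  -- For a constant `p` the vector of derivatives is empty, and `htop` itself reads `g = 0`.
  rcases Nat.eq_zero_or_pos n with h' | h'
  · have h2 := htop t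
    have : IsEmpty (Fin n) := by rw [h']; infer_instance
    rw [Finset.univ_eq_empty, Finset.sum_empty, h', iteratedDeriv_zero] at h2
    exact h2
  · have h2 := congrFun (congrFun key t) ⟨0, h'⟩
    simpa using h2

/-- The action of a polynomial matrix on tuples of smooth functions. -/
def act {m n : ℕ} (R : Matrix (Fin m) (Fin n) ℝ[X]) (F : Fin n → SmoothFun) : Fin m → SmoothFun :=
  fun i => ∑ j, R i j • F j

variable {m n k : ℕ}

lemma act_mul (A : Matrix (Fin m) (Fin n) ℝ[X]) (B : Matrix (Fin n) (Fin k) ℝ[X])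
    (F : Fin k → SmoothFun) : act (A * B) F = act A (act B F) := by
  funext i
  simp only [act, Matrix.mul_apply, Finset.sum_smul, Finset.smul_sum, mul_smul]
  exact Finset.sum_comm

lemma act_one (F : Fin n → SmoothFun) : act 1 F = F := by
  funext i
  simp [act, Matrix.one_apply, ite_smul]

lemma act_zero (A : Matrix (Fin m) (Fin n) ℝ[X]) : act A 0 = 0 := by
  funext i
  simp [act]

lemma act_sub (A B : Matrix (Fin m) (Fin n) ℝ[X]) (F : Fin n → SmoothFun) :
    act (A - B) F = act A F - act B F := by
  funext i
  simp [act, sub_smul]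

lemma act_congr (A : Matrix (Fin m) (Fin n) ℝ[X]) {F G : Fin n → SmoothFun} {t : ℝ}
    (h : ∀ j, (F j).1 =ᶠ[nhds t] (G j).1) (i : Fin m) : (act A F i).1 t = (act A G i).1 t := by
  simp only [act, AddSubmonoidClass.coe_finsetSum, Finset.sum_apply]
  exact Finset.sum_congr rfl fun j _ => smul_congr _ (h j)

lemma act_expRe (A : Matrix (Fin m) (Fin n) ℝ[X]) (z : ℂ) (c : Fin n → ℂ) :
    act A (fun j => expRe z (c j)) = fun i => expRe z ((evalAt A z).mulVec c i) := by
  funext i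
  simp [act, smul_expRe, Matrix.mulVec, dotProduct, evalAt]

/-- The trajectory with given smooth components. -/
def traj (F : Fin n → SmoothFun) : ℝ → Fin n → ℝ := fun t j => (F j).1 t

lemma traj_mem_kerDiff {R : Matrix (Fin m) (Fin n) ℝ[X]} {F : Fin n → SmoothFun} :
    traj F ∈ kerDiff R ↔ act R F = 0 := by
  have h1 : ContDiff ℝ ∞ (traj F) := contDiff_pi.2 fun j => (F j).2
  have h2 : ∀ i t, ∑ j, diffOp (R i j) (fun s => traj F s j) t = (act R F i).1 t := by
    intro i t
    simp only [act, AddSubmonoidClass.coe_finsetSum, Finset.sum_apply, smul_apply]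
    rfl
  constructor
  · intro h
    funext i
    ext t
    rw [← h2, h.2]
    rfl
  · intro h
    refine ⟨h1, fun i t => ?_⟩
    rw [h2, h]
    rfl

lemma exists_traj_of_mem_kerDiff {R : Matrix (Fin m) (Fin n) ℝ[X]} {f : ℝ → Fin n → ℝ}
    (hf : f ∈ kerDiff R) : ∃ F, f = traj F :=
  ⟨fun j => ⟨fun t => f t j, contDiff_pi.1 hf.1 j⟩, rfl⟩

end SmoothFun

/-! ### Exponential trajectories and patching in kernels -/

open SmoothFun

variable {m n k : ℕ}

lemma kerDiff_subset_kerDiff_mul (A : Matrix (Fin m) (Fin n) ℝ[X])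
    (B : Matrix (Fin n) (Fin k) ℝ[X]) : kerDiff B ⊆ kerDiff (A * B) := by
  intro f hf
  obtain ⟨F, rfl⟩ := exists_traj_of_mem_kerDiff hf
  rw [traj_mem_kerDiff] at hf ⊢
  rw [act_mul, hf, act_zero]

/-- Exponential trajectories detect the kernels of the evaluated matrices. -/
lemma mulVec_evalAt_eq_zero_of_kerDiff_subset {A : Matrix (Fin m) (Fin k) ℝ[X]}
    {B : Matrix (Fin n) (Fin k) ℝ[X]} (h : kerDiff A ⊆ kerDiff B) (z : ℂ) (c : Fin k → ℂ)
    (hc : (evalAt A z).mulVec c = 0) : (evalAt B z).mulVec c = 0 := by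
  have main : ∀ c : Fin k → ℂ, (evalAt A z).mulVec c = 0 →
      ∀ i, ((evalAt B z).mulVec c i).re = 0 := by
    intro c hc i
    have h1 : traj (fun j => expRe z (c j)) ∈ kerDiff A := by
      rw [traj_mem_kerDiff, act_expRe, hc]
      funext i
      simp
    have h2 := traj_mem_kerDiff.1 (h h1)
    rw [act_expRe] at h2
    rw [← expRe_apply_zero z, congrFun h2 i]
    rfl
  funext i
  refine Complex.ext (main c hc i) ?_
  -- Only real parts are visible to real trajectories; multiplying `c` by `I` exposes the imaginary
  -- part.
  have h3 := main (Complex.I • c) (by rw [Matrix.mulVec_smul, hc, smul_zero]) i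
  rw [Matrix.mulVec_smul] at h3
  simpa using h3

/-- The kernel of a right invertible polynomial matrix has an image representation, hence any two
trajectories can be patched. -/
lemma exists_patch_of_mul_eq_one {V : Matrix (Fin m) (Fin n) ℝ[X]}
    {Φ : Matrix (Fin n) (Fin m) ℝ[X]} (hV : V * Φ = 1) {f₁ f₂ : ℝ → Fin n → ℝ}
    (h₁ : f₁ ∈ kerDiff V) (h₂ : f₂ ∈ kerDiff V) :
    ∃ f₃ ∈ kerDiff V, ∃ τ : ℝ, 0 < τ ∧ (∀ t ≤ 0, f₃ t = f₁ t) ∧ ∀ t, τ ≤ t → f₃ t = f₂ t := by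
  obtain ⟨F, rfl⟩ := exists_traj_of_mem_kerDiff h₁
  obtain ⟨G, rfl⟩ := exists_traj_of_mem_kerDiff h₂
  rw [traj_mem_kerDiff] at h₁ h₂
  -- `1 - Φ * V` fixes the kernel of `V` and maps everything into it. So the two trajectories may be
  -- blended by a cutoff and then projected back.
  have hfix : ∀ F, act V F = 0 → act (1 - Φ * V) F = F := by
    intro F hF
    rw [act_sub, act_one, act_mul, hF, act_zero, sub_zero]
  let H : Fin n → SmoothFun := fun j =>
    ⟨fun t => (F j).1 t + Real.smoothTransition (t - 1) * ((G j).1 t - (F j).1 t),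
      (SmoothFun.contDiff (F j)).add ((Real.smoothTransition.contDiff.comp (contDiff_id.sub contDiff_const)).mul
        ((SmoothFun.contDiff (G j)).sub (SmoothFun.contDiff (F j))))⟩
  -- The cutoff moves only on `[1, 2]`, so the blend agrees with the given trajectories on
  -- neighborhoods of all `t ≤ 0` and `t ≥ 3`, as a differential operator requires.
  refine ⟨traj (act (1 - Φ * V) H), ?_, 3, by norm_num, fun t ht => ?_, fun t ht => ?_⟩
  · rw [traj_mem_kerDiff, ← act_mul, Matrix.mul_sub, ← Matrix.mul_assoc, hV, Matrix.mul_one,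
      Matrix.one_mul, sub_self]
    funext i
    simp [act]
  · funext i
    change (act (1 - Φ * V) H i).1 t = (F i).1 t
    conv_rhs => rw [← hfix F h₁]
    refine act_congr _ (fun j => ?_) i
    filter_upwards [Iio_mem_nhds (show t < 1 by linarith)] with s hs
    have : Real.smoothTransition (s - 1) = 0 :=
      Real.smoothTransition.zero_of_nonpos (by linarith [Set.mem_Iio.1 hs])
    simp [H, this]
  · funext i
    change (act (1 - Φ * V) H i).1 t = (G i).1 t
    conv_rhs => rw [← hfix G h₂]
    refine act_congr _ (fun j => ?_) i
    filter_upwards [Ioi_mem_nhds (show 2 < t by linarith)] with s hs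
    have : Real.smoothTransition (s - 1) = 1 :=
      Real.smoothTransition.one_of_one_le (by linarith [Set.mem_Ioi.1 hs])
    simp [H, this]

end

noncomputable section

/-! ### Row modules over a principal ideal domain -/

section PrincipalIdeal

open Matrix

variable {K : Type*} [CommRing K] {m n w : ℕ}

/-- The row span of a matrix. -/
abbrev rowSpan (R : Matrix (Fin m) (Fin w) K) : Submodule K (Fin w → K) :=
  Submodule.span K (Set.range R)

lemma exists_eq_mul_of_forall_mem_rowSpan {R : Matrix (Fin m) (Fin w) K}
    {V : Matrix (Fin n) (Fin w) K} (h : ∀ i, V i ∈ rowSpan R) :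
    ∃ L : Matrix (Fin n) (Fin m) K, V = L * R := by
  choose c hc using fun i => (Submodule.mem_span_range_iff_exists_fun K).1 (h i)
  refine ⟨Matrix.of c, ?_⟩
  ext i j
  have h1 := congrFun (hc i) j
  rw [Matrix.mul_apply, ← h1, Finset.sum_apply]
  rfl

variable [IsDomain K] [IsPrincipalIdealRing K]

/-- A matrix over a principal ideal domain factors through its rank. -/
theorem exists_rank_factorization (R : Matrix (Fin m) (Fin w) K) :
    ∃ (n : ℕ) (C : Matrix (Fin m) (Fin n) K) (B : Matrix (Fin n) (Fin w) K)
      (L : Matrix (Fin n) (Fin m) K) (F : Matrix (Fin w) (Fin n) K) (a : Fin n → K),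
      R = C * B ∧ L * R * F = diagonal a ∧ ∀ i, a i ≠ 0 := by
  -- The rows of `B` are a basis of the row span, multiples `a i` of members of a basis of the whole
  -- space; `F` reads off the corresponding coordinates.
  obtain ⟨n, bM, bN, f, a, h⟩ := (rowSpan R).smithNormalForm (Pi.basisFun K (Fin w))
  let B : Matrix (Fin n) (Fin w) K := fun i => bN i
  obtain ⟨L, hL⟩ := exists_eq_mul_of_forall_mem_rowSpan (V := B) (fun i => (bN i).2)
  let F : Matrix (Fin w) (Fin n) K := fun j i => bM.repr (Pi.single j 1) (f i)
  have hrow : ∀ i, R i ∈ rowSpan R := fun i => Submodule.subset_span ⟨i, rfl⟩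
  refine ⟨n, Matrix.of fun i k => bN.repr ⟨R i, hrow i⟩ k, B, L, F, a, ?_, ?_, fun i hi => ?_⟩
  · ext i j
    have h1 := congrArg Subtype.val (bN.sum_repr ⟨R i, hrow i⟩)
    have h2 := congrFun h1 j
    rw [Matrix.mul_apply]
    refine h2.symm.trans ?_
    rw [Submodule.coe_sum, Finset.sum_apply]
    rfl
  · rw [← hL]
    ext i k
    have h1 : ∀ x : Fin w → K, ∑ j, x j * F j k = bM.repr x (f k) := by
      intro x
      conv_rhs => rw [pi_eq_sum_univ' x]
      simp [F, map_sum, map_smul]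
    rw [Matrix.mul_apply, h1]
    simp only [B, h, map_smul, Finsupp.smul_apply, bM.repr_self, Finsupp.single_apply, diagonal_apply,
      f.injective.eq_iff]
    simp
  · refine bN.ne_zero i (Subtype.ext ?_)
    rw [h, hi, zero_smul]
    rfl

/-- A maximal unimodular part of a submodule: on the complement, all coordinates have a common
divisor that is not a unit. -/
theorem exists_split_reduction (N : Submodule K (Fin w → K)) :
    ∃ (s : ℕ) (V : Matrix (Fin s) (Fin w) K) (Φ : Matrix (Fin w) (Fin s) K) (d : K),
      V * Φ = 1 ∧ (∀ i, V i ∈ N) ∧ ¬ IsUnit d ∧ ∀ u ∈ N, u ᵥ* Φ = 0 → ∀ j, d ∣ u j := by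
  classical
  let P : ℕ → Prop := fun s => ∃ (V : Matrix (Fin s) (Fin w) K) (Φ : Matrix (Fin w) (Fin s) K),
    V * Φ = 1 ∧ ∀ i, V i ∈ N
  have hbound : ∀ s, P s → s ≤ w := by
    rintro s ⟨V, Φ, h, -⟩
    have h1 := rank_mul_le_left V Φ
    rw [h, rank_one, Fintype.card_fin] at h1
    exact h1.trans (rank_le_width V)
  have hP0 : P 0 := ⟨fun i => i.elim0, fun _ i => i.elim0, by ext i; exact i.elim0,
    fun i => i.elim0⟩
  set s := Nat.findGreatest P w
  obtain ⟨V, Φ, hVΦ, hVN⟩ : P s := Nat.findGreatest_spec (Nat.zero_le w) hP0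
  have hmax : ¬ P (s + 1) := fun h => by
    have := Nat.le_findGreatest (hbound _ h) h
    omega
  let N' : Submodule K (Fin w → K) := N ⊓ LinearMap.ker (Matrix.vecMulLinear Φ)
  have hN' : ∀ u, u ∈ N' ↔ u ∈ N ∧ u ᵥ* Φ = 0 := fun u => Iff.rfl
  -- Values of a functional `φ` on the complement `N'`. As in the proof of the Smith normal form, a
  -- maximal such ideal is taken; its generator `a`, attained at `n`, is the required divisor.
  let I : (Fin w → K) → Ideal K := fun φ => N'.map ((dotProductBilin K K).flip φ)
  have hI : ∀ φ x, x ∈ I φ ↔ ∃ u ∈ N', u ⬝ᵥ φ = x := fun φ x => Iff.rfl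
  obtain ⟨_, ⟨φ, rfl⟩, hφ⟩ := set_has_maximal_iff_noetherian.2
    (inferInstanceAs (IsNoetherian K K)) (Set.range I) ⟨_, 0, rfl⟩
  obtain ⟨a, ha⟩ := (IsPrincipalIdealRing.principal (I φ)).principal
  have haI : a ∈ I φ := by rw [ha]; exact Submodule.mem_span_singleton_self a
  obtain ⟨n, hn, hna⟩ := (hI _ _).1 haI
  have hdvd : ∀ x, x ∈ I φ ↔ a ∣ x := fun x => by
    rw [ha]; exact Ideal.mem_span_singleton
  have hle : ∀ ψ, I φ ≤ I ψ → I ψ ≤ I φ := fun ψ h => by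
    by_contra h'
    exact hφ _ ⟨ψ, rfl⟩ (lt_of_le_not_ge h h')
  have hψn : ∀ ψ, a ∣ n ⬝ᵥ ψ := by
    intro ψ
    -- The gcd `g` of `a` and `n ⬝ᵥ ψ` is the value at `n` of a combination of `φ` and `ψ`, so
    -- maximality of `I φ` forces `a ∣ g`.
    obtain ⟨g, hg⟩ := (IsPrincipalIdealRing.principal (Ideal.span {a, n ⬝ᵥ ψ})).principal
    have hg1 : g ∈ Ideal.span {a, n ⬝ᵥ ψ} := by
      rw [hg]; exact Submodule.mem_span_singleton_self g
    obtain ⟨x, y, hxy⟩ := Ideal.mem_span_pair.1 hg1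
    have hgm : ∀ z, z ∈ Ideal.span {a, n ⬝ᵥ ψ} → g ∣ z := fun z hz => by
      rw [hg] at hz; exact Ideal.mem_span_singleton.1 hz
    have hg2 : g ∈ I (x • φ + y • ψ) := (hI _ _).2 ⟨n, hn, by
      rw [dotProduct_add, dotProduct_smul, dotProduct_smul, hna, smul_eq_mul, smul_eq_mul, hxy]⟩
    have h1 : I φ ≤ I (x • φ + y • ψ) := fun z hz =>
      Ideal.mem_of_dvd _ ((hgm a (Ideal.subset_span (by simp))).trans ((hdvd z).1 hz)) hg2
    exact ((hdvd g).1 (hle _ h1 hg2)).trans (hgm _ (Ideal.subset_span (by simp)))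
  refine ⟨s, V, Φ, a, hVΦ, hVN, fun hu => hmax ?_, fun u huN hu j => ?_⟩
  · obtain ⟨b, hb⟩ := hu.exists_left_inv
    -- Were `a` a unit, `n` could be appended to `V`: this correction makes `V` kill `φ'` and keeps
    -- `n ⬝ᵥ φ' = 1`, since `n` kills `Φ`.
    let φ' := b • φ - Φ *ᵥ (V *ᵥ (b • φ))
    have hn0 : n ᵥ* Φ = 0 := ((hN' n).1 hn).2
    refine ⟨Matrix.of (Fin.cons n V), Matrix.of fun j => Fin.cons (φ' j) (Φ j), ?_, fun i => ?_⟩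
    · ext i k
      refine Fin.cases ?_ (fun i => ?_) i <;> refine Fin.cases ?_ (fun k => ?_) k
      · change n ⬝ᵥ φ' = _
        simp only [φ']
        rw [dotProduct_sub, dotProduct_mulVec, hn0, zero_dotProduct, dotProduct_smul, hna,
          smul_eq_mul, hb, sub_zero, one_apply_eq]
      · change (n ᵥ* Φ) k = _
        rw [hn0, one_apply_ne (Fin.succ_ne_zero k).symm]
        rfl
      · change (V *ᵥ φ') i = _
        simp only [φ']
        rw [mulVec_sub, mulVec_mulVec, hVΦ, one_mulVec, sub_self,
          one_apply_ne (Fin.succ_ne_zero i)]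
        rfl
      · change (V * Φ) i k = _
        rw [hVΦ]
        simp [Matrix.one_apply]
    · refine Fin.cases ?_ (fun i => ?_) i
      · exact ((hN' n).1 hn).1
      · exact hVN i
  · have key : ∀ v ∈ N', v ⬝ᵥ φ = 0 → ∀ ψ, n ⬝ᵥ ψ = 0 → a ∣ v ⬝ᵥ ψ := by
      intro v hv hv0 ψ hψ
      have h1 : I φ ≤ I (φ + ψ) := fun z hz => Ideal.mem_of_dvd _ ((hdvd z).1 hz)
        ((hI _ _).2 ⟨n, hn, by rw [dotProduct_add, hna, hψ, add_zero]⟩)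
      exact (hdvd _).1 (hle _ h1 ((hI _ _).2 ⟨v, hv, by rw [dotProduct_add, hv0, zero_add]⟩))
    have huN' : u ∈ N' := (hN' u).2 ⟨huN, hu⟩
    obtain ⟨c, hc⟩ := (hdvd _).1 ((hI φ (u ⬝ᵥ φ)).2 ⟨u, huN', rfl⟩)
    obtain ⟨e, he⟩ := hψn (Pi.single j 1)
    -- Removing the `n` part of `u` and the `φ` part of the coordinate functional meets the
    -- hypotheses of `key`; the terms removed contribute a multiple of `a`.
    have h2 := key (u - c • n) (N'.sub_mem huN' (N'.smul_mem c hn))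
      (by rw [sub_dotProduct, smul_dotProduct, hna, hc, smul_eq_mul]; ring)
      (Pi.single j 1 - e • φ) (by rw [dotProduct_sub, dotProduct_smul, hna, he, smul_eq_mul]; ring)
    have h3 : (u - c • n) ⬝ᵥ (Pi.single j 1 - e • φ) = u j - c * (a * e) := by
      rw [dotProduct_sub, dotProduct_smul, sub_dotProduct, sub_dotProduct, smul_dotProduct,
        smul_dotProduct, he, hna, hc]
      simp only [smul_eq_mul, dotProduct_single_one]
      ring
    rw [h3] at h2
    have h4 := dvd_add h2 ((Dvd.intro e rfl : a ∣ a * e).mul_left c)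
    rwa [sub_add_cancel] at h4

end PrincipalIdeal

end

/-! ### Ranks of the values of a polynomial matrix -/

noncomputable section

open SmoothFun Matrix

variable {m n k p w s : ℕ}

lemma evalAt_mul (A : Matrix (Fin m) (Fin n) ℝ[X]) (B : Matrix (Fin n) (Fin k) ℝ[X]) (z : ℂ) :
    evalAt (A * B) z = evalAt A z * evalAt B z :=
  Matrix.map_mul (f := (aeval z : ℝ[X] →ₐ[ℝ] ℂ).toRingHom)

lemma evalAt_one (z : ℂ) : evalAt (1 : Matrix (Fin n) (Fin n) ℝ[X]) z = 1 :=
  Matrix.map_one _ (map_zero _) (map_one _)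

lemma evalAt_sub (A B : Matrix (Fin m) (Fin n) ℝ[X]) (z : ℂ) :
    evalAt (A - B) z = evalAt A z - evalAt B z :=
  Matrix.map_sub _ (map_sub _) A B

lemma eq_zero_of_aeval_eq_zero {q : ℝ[X]} (h : ∀ z : ℂ, aeval z q = 0) : q = 0 := by
  refine Polynomial.funext fun x => ?_
  have := h x
  rw [← Complex.coe_algebraMap, aeval_algebraMap_apply] at this
  simpa using this

lemma exists_aeval_eq_zero_of_not_isUnit {d : ℝ[X]} (hd : ¬ IsUnit d) :
    ∃ z : ℂ, aeval z d = 0 := by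
  by_cases h : d = 0
  · exact ⟨0, by simp [h]⟩
  · refine IsAlgClosed.exists_aeval_eq_zero ℂ d fun h0 => hd ?_
    exact isUnit_iff_degree_eq_zero.2 h0

lemma le_rank_of_mul_mul_eq_diagonal {K : Type*} [CommRing K] [IsDomain K]
    {L : Matrix (Fin n) (Fin m) K} {R : Matrix (Fin m) (Fin w) K} {F : Matrix (Fin w) (Fin n) K}
    {a : Fin n → K} (h : L * R * F = diagonal a) (ha : ∀ i, a i ≠ 0) : n ≤ R.rank := by
  have h1 : (diagonal a).rank = n := by
    rw [rank_of_det_ne_zero, Fintype.card_fin]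
    rw [det_diagonal]
    exact Finset.prod_ne_zero_iff.2 fun i _ => ha i
  rw [← h1, ← h]
  exact (rank_mul_le_left _ _).trans (rank_mul_le_right _ _)

lemma le_rank_of_mul_mul_eq_one {K : Type*} [CommRing K] [IsDomain K]
    {L : Matrix (Fin n) (Fin m) K} {R : Matrix (Fin m) (Fin w) K} {F : Matrix (Fin w) (Fin n) K}
    (h : L * R * F = 1) : n ≤ R.rank :=
  le_rank_of_mul_mul_eq_diagonal (a := fun _ => 1) (by rw [h, diagonal_one]) fun _ => one_ne_zero

lemma rank_mul_le_inner {K : Type*} [CommRing K] [IsDomain K]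
    (C : Matrix (Fin m) (Fin n) K) (B : Matrix (Fin n) (Fin w) K) : (C * B).rank ≤ n :=
  (rank_mul_le_left _ _).trans (rank_le_width _)

/-- The rank of a polynomial matrix is the largest rank of its values. -/
theorem rank_evalAt_le_and_exists_eq (R : Matrix (Fin p) (Fin w) ℝ[X]) :
    (∀ z, (evalAt R z).rank ≤ R.rank) ∧ ∃ z, (evalAt R z).rank = R.rank := by
  obtain ⟨n, C, B, L, F, a, hR, hL, ha⟩ := exists_rank_factorization R
  have h1 : n ≤ R.rank := le_rank_of_mul_mul_eq_diagonal hL ha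
  have h2 : R.rank ≤ n := by rw [hR]; exact rank_mul_le_inner _ _
  have h3 : ∀ z, (evalAt R z).rank ≤ n := by
    intro z
    rw [hR, evalAt_mul]
    exact rank_mul_le_inner _ _
  refine ⟨fun z => (h3 z).trans h1, ?_⟩
  -- The rank is attained wherever no diagonal entry of the factorization vanishes.
  have h4 : ∃ z : ℂ, aeval z (∏ i, a i) ≠ 0 := by
    by_contra! h
    exact Finset.prod_ne_zero_iff.2 (fun i _ => ha i) (eq_zero_of_aeval_eq_zero h)
  obtain ⟨z, hz⟩ := h4
  rw [map_prod, Finset.prod_ne_zero_iff] at hz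
  refine ⟨z, le_antisymm ((h3 z).trans h1) (h2.trans ?_)⟩
  have h5 : evalAt L z * evalAt R z * evalAt F z = diagonal fun i => aeval z (a i) := by
    rw [← evalAt_mul, ← evalAt_mul, hL]
    exact diagonal_map (map_zero _)
  exact le_rank_of_mul_mul_eq_diagonal h5 fun i => hz i (Finset.mem_univ i)

lemma finrank_ker_mulVecLin_add_rank (A : Matrix (Fin m) (Fin n) ℂ) :
    A.rank + Module.finrank ℂ (LinearMap.ker A.mulVecLin) = n := by
  have := LinearMap.finrank_range_add_finrank_ker A.mulVecLin
  rwa [Module.finrank_fin_fun] at this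

lemma rank_le_of_ker_le {A : Matrix (Fin m) (Fin n) ℂ} {B : Matrix (Fin k) (Fin n) ℂ}
    (h : ∀ c, A *ᵥ c = 0 → B *ᵥ c = 0) : B.rank ≤ A.rank := by
  have h1 : LinearMap.ker A.mulVecLin ≤ LinearMap.ker B.mulVecLin := fun c hc => h c hc
  have h2 := Submodule.finrank_mono h1
  have h3 := finrank_ker_mulVecLin_add_rank A
  have h4 := finrank_ker_mulVecLin_add_rank B
  omega

lemma ker_le_of_rank_eq {A : Matrix (Fin m) (Fin n) ℂ} {B : Matrix (Fin k) (Fin n) ℂ}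
    (h : ∀ c, A *ᵥ c = 0 → B *ᵥ c = 0) (hr : B.rank = A.rank) (c : Fin n → ℂ)
    (hc : B *ᵥ c = 0) : A *ᵥ c = 0 := by
  have h1 : LinearMap.ker A.mulVecLin ≤ LinearMap.ker B.mulVecLin := fun c hc => h c hc
  have h3 := finrank_ker_mulVecLin_add_rank A
  have h4 := finrank_ker_mulVecLin_add_rank B
  have h5 := Submodule.eq_of_le_of_finrank_eq h1 (by omega)
  have : c ∈ LinearMap.ker B.mulVecLin := hc
  rw [← h5] at this
  exact this

lemma rank_evalAt_le_of_kerDiff_subset {A : Matrix (Fin m) (Fin w) ℝ[X]}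
    {B : Matrix (Fin n) (Fin w) ℝ[X]} (h : kerDiff A ⊆ kerDiff B) (z : ℂ) :
    (evalAt B z).rank ≤ (evalAt A z).rank :=
  rank_le_of_ker_le (mulVec_evalAt_eq_zero_of_kerDiff_subset h z)

/-- Compare the values at a point where `B` attains its rank. Applied in both directions, this makes
the input cardinality independent of the representation. -/
lemma rank_le_of_kerDiff_subset {A : Matrix (Fin m) (Fin w) ℝ[X]}
    {B : Matrix (Fin n) (Fin w) ℝ[X]} (h : kerDiff A ⊆ kerDiff B) : B.rank ≤ A.rank := by
  obtain ⟨z, hz⟩ := (rank_evalAt_le_and_exists_eq B).2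
  rw [← hz]
  exact (rank_evalAt_le_of_kerDiff_subset h z).trans ((rank_evalAt_le_and_exists_eq A).1 z)

/-- A matrix whose values vanish on the kernels of the values of a right invertible matrix
factors through the latter. -/
lemma eq_mul_mul_of_evalAt {V : Matrix (Fin s) (Fin w) ℝ[X]} {Φ : Matrix (Fin w) (Fin s) ℝ[X]}
    (hV : V * Φ = 1) {R : Matrix (Fin p) (Fin w) ℝ[X]}
    (h : ∀ z c, evalAt V z *ᵥ c = 0 → evalAt R z *ᵥ c = 0) : R = R * Φ * V := by
  -- The columns of `1 - Φ * V` lie in the kernel of `V(z)` for every `z`, hence in that of `R(z)`.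
  have h0 : R * (1 - Φ * V) = 0 := by
    ext1 i j
    refine eq_zero_of_aeval_eq_zero fun z => ?_
    have h1 : evalAt V z *ᵥ (evalAt (1 - Φ * V) z *ᵥ Pi.single j 1) = 0 := by
      rw [mulVec_mulVec, ← evalAt_mul, Matrix.mul_sub, ← Matrix.mul_assoc, hV, Matrix.mul_one,
        Matrix.one_mul, evalAt_sub, sub_self, zero_mulVec]
    have h2 := congrFun (h z _ h1) i
    rw [mulVec_mulVec, ← evalAt_mul, mulVec_single_one] at h2
    exact h2
  rw [Matrix.mul_sub, Matrix.mul_one, sub_eq_zero, ← Matrix.mul_assoc] at h0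
  exact h0

/-- A nonzero coordinate has finite multiplicity at `q`, so a largest power can be taken out. For
irreducible `q`, what remains does not vanish at the roots of `q`. -/
lemma exists_eq_pow_smul {q : ℝ[X]} (hq : ¬ IsUnit q) {u : Fin w → ℝ[X]} (hu : u ≠ 0) :
    ∃ (k : ℕ) (v : Fin w → ℝ[X]), u = q ^ k • v ∧ ∃ j, ¬ q ∣ v j := by
  classical
  have hex : ∃ k, ∃ j, ¬ q ^ k ∣ u j := by
    obtain ⟨j, hj⟩ := Function.ne_iff.1 hu
    obtain ⟨k, hk⟩ := FiniteMultiplicity.of_not_isUnit hq hj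
    exact ⟨k + 1, j, hk⟩
  obtain ⟨k, hk⟩ : ∃ k, Nat.find hex = k + 1 := by
    refine Nat.exists_eq_succ_of_ne_zero fun h0 => ?_
    obtain ⟨j, hj⟩ := Nat.find_spec hex
    rw [h0] at hj
    simp at hj
  have h1 : ∀ j, q ^ k ∣ u j := by
    have := Nat.find_min hex (m := k) (by omega)
    push Not at this
    exact this
  choose v hv using h1
  refine ⟨k, v, funext hv, ?_⟩
  obtain ⟨j, hj⟩ := Nat.find_spec hex
  refine ⟨j, fun h => hj ?_⟩
  rw [hk, hv, pow_succ]
  exact mul_dvd_mul_left _ h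

/-! ### Split reductions, minimal rank and the obstruction to controllability -/

/-- A right invertible part `V` of the row span of `R` with `s` rows, such that the part of `R`
complementary to `V` is divisible by the non-unit `d`. -/
structure SplitReduction (R : Matrix (Fin p) (Fin w) ℝ[X]) (s : ℕ) where
  V : Matrix (Fin s) (Fin w) ℝ[X]
  Φ : Matrix (Fin w) (Fin s) ℝ[X]
  L : Matrix (Fin s) (Fin p) ℝ[X]
  d : ℝ[X]
  V_mul_Φ : V * Φ = 1
  V_eq : V = L * R
  not_isUnit_d : ¬ IsUnit d
  d_dvd : ∀ i j, d ∣ (R - R * Φ * V) i j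

theorem exists_splitReduction (R : Matrix (Fin p) (Fin w) ℝ[X]) :
    ∃ s, Nonempty (SplitReduction R s) := by
  obtain ⟨s, V, Φ, d, h1, h2, h3, h4⟩ := exists_split_reduction (rowSpan R)
  obtain ⟨L, hL⟩ := exists_eq_mul_of_forall_mem_rowSpan h2
  refine ⟨s, ⟨V, Φ, L, d, h1, hL, h3, fun i => h4 _ ?_ ?_⟩⟩
  · have h5 : R - R * Φ * V = (1 - R * Φ * L) * R := by
      rw [Matrix.sub_mul, Matrix.one_mul, Matrix.mul_assoc (R * Φ), ← hL]
    rw [h5]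
    refine (Submodule.mem_span_range_iff_exists_fun _).2 ⟨(1 - R * Φ * L : Matrix (Fin p) (Fin p) ℝ[X]) i, ?_⟩
    ext1 j
    rw [Matrix.mul_apply, Finset.sum_apply]
    rfl
  · have h5 : (R - R * Φ * V) * Φ = 0 := by
      rw [Matrix.sub_mul, Matrix.mul_assoc _ V, h1, Matrix.mul_one, sub_self]
    exact congrFun h5 i

namespace SplitReduction

variable {R : Matrix (Fin p) (Fin w) ℝ[X]} (σ : SplitReduction R s)

/-- The part of `R` complementary to `V`. -/
def T : Matrix (Fin p) (Fin w) ℝ[X] := R - R * σ.Φ * σ.V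

lemma T_eq : σ.T = (1 - R * σ.Φ * σ.L) * R := by
  rw [Matrix.sub_mul, Matrix.one_mul, Matrix.mul_assoc (R * σ.Φ), ← σ.V_eq, T]

lemma T_mul_Φ : σ.T * σ.Φ = 0 := by
  rw [T, Matrix.sub_mul, Matrix.mul_assoc _ σ.V, σ.V_mul_Φ, Matrix.mul_one, sub_self]

lemma T_eq_zero_iff : σ.T = 0 ↔ R = R * σ.Φ * σ.V := sub_eq_zero

lemma le_rank_evalAt (σ : SplitReduction R s) (z : ℂ) : s ≤ (evalAt R z).rank := by
  refine le_rank_of_mul_mul_eq_one (L := evalAt σ.L z) (F := evalAt σ.Φ z) ?_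
  rw [← evalAt_mul, ← evalAt_mul, ← σ.V_eq, σ.V_mul_Φ, evalAt_one]

lemma rank_V : σ.V.rank = s :=
  le_antisymm (rank_le_height _)
    (le_rank_of_mul_mul_eq_one (L := 1) (F := σ.Φ) (by rw [Matrix.one_mul, σ.V_mul_Φ]))

lemma evalAt_eq_of_T {z : ℂ} (h : ∀ i j, aeval z (σ.T i j) = 0) :
    evalAt R z = evalAt R z * evalAt σ.Φ z * evalAt σ.V z := by
  rw [← evalAt_mul, ← evalAt_mul, ← sub_eq_zero, ← evalAt_sub]
  ext i j
  exact h i j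

lemma evalAt_eq {z : ℂ} (hz : aeval z σ.d = 0) :
    evalAt R z = evalAt R z * evalAt σ.Φ z * evalAt σ.V z :=
  σ.evalAt_eq_of_T fun i j => by
    obtain ⟨e, he⟩ := σ.d_dvd i j
    rw [T, he, map_mul, hz, zero_mul]

/-- At a root of `d` the part `T` vanishes and `R(z)` factors through the `s` rows of `V(z)`. With
`le_rank_evalAt`, this identifies `s` as the minimal rank. -/
lemma rank_evalAt_eq {z : ℂ} (hz : aeval z σ.d = 0) : (evalAt R z).rank = s := by
  refine le_antisymm ?_ (σ.le_rank_evalAt z)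
  rw [σ.evalAt_eq hz]
  exact rank_mul_le_inner _ _

lemma exists_root : ∃ z : ℂ, aeval z σ.d = 0 := exists_aeval_eq_zero_of_not_isUnit σ.not_isUnit_d

lemma rank_evalAt_of_T_eq_zero (h : σ.T = 0) (z : ℂ) : (evalAt R z).rank = s := by
  refine le_antisymm ?_ (σ.le_rank_evalAt z)
  rw [σ.evalAt_eq_of_T (fun i j => by rw [h]; simp)]
  exact rank_mul_le_inner _ _

lemma rank_of_T_eq_zero (h : σ.T = 0) : R.rank = s := by
  obtain ⟨z, hz⟩ := (rank_evalAt_le_and_exists_eq R).2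
  rw [← hz, σ.rank_evalAt_of_T_eq_zero h]

lemma le_rank (σ : SplitReduction R s) : s ≤ R.rank :=
  (σ.le_rank_evalAt 0).trans ((rank_evalAt_le_and_exists_eq R).1 0)

lemma kerDiff_subset : kerDiff R ⊆ kerDiff σ.V := by
  rw [σ.V_eq]
  exact kerDiff_subset_kerDiff_mul _ _

/-- If the rank were `s`, then `R(z)` and `V(z)` would have nested kernels of equal dimension for
all `z`, so `R` would factor through `V`. -/
lemma lt_rank (h : σ.T ≠ 0) : s < R.rank := by
  refine lt_of_le_of_ne σ.le_rank fun hs => h (σ.T_eq_zero_iff.2 ?_)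
  refine eq_mul_mul_of_evalAt σ.V_mul_Φ fun z c hc => ?_
  refine ker_le_of_rank_eq (mulVec_evalAt_eq_zero_of_kerDiff_subset σ.kerDiff_subset z) ?_ c hc
  have h1 : s ≤ (evalAt σ.V z).rank := by
    refine le_rank_of_mul_mul_eq_one (L := 1) (F := evalAt σ.Φ z) ?_
    rw [Matrix.one_mul, ← evalAt_mul, σ.V_mul_Φ, evalAt_one]
  have h2 := rank_le_height (evalAt σ.V z)
  have h3 := (rank_evalAt_le_and_exists_eq R).1 z
  have h4 := σ.le_rank_evalAt z
  omega

/-- If the complementary part does not vanish, some trajectory cannot be patched to zero. -/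
theorem T_eq_zero_of_patch
    (h : ∀ f₁ ∈ kerDiff R, ∀ f₂ ∈ kerDiff R, ∃ f₃ ∈ kerDiff R, ∃ τ : ℝ, 0 < τ ∧
      (∀ t ≤ 0, f₃ t = f₁ t) ∧ ∀ t, τ ≤ t → f₃ t = f₂ t) : σ.T = 0 := by
  by_contra hT
  obtain ⟨i, hi⟩ := Function.ne_iff.1 hT
  have hd : σ.d ≠ 0 := by
    intro hd
    refine hT ?_
    ext1 i j
    have := σ.d_dvd i j
    rw [hd, zero_dvd_iff] at this
    exact this
  obtain ⟨q, hq, hqd⟩ := WfDvdMonoid.exists_irreducible_factor σ.not_isUnit_d hd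
  obtain ⟨k, v, hv, j, hj⟩ := exists_eq_pow_smul hq.not_isUnit hi
  obtain ⟨z, hz⟩ := exists_aeval_eq_zero_of_not_isUnit hq.not_isUnit
  have hzd : aeval z σ.d = 0 := by
    obtain ⟨e, he⟩ := hqd
    rw [he, map_mul, hz, zero_mul]
  have hvj : aeval z (v j) ≠ 0 := by
    intro h0
    obtain ⟨a, b, hab⟩ := (hq.coprime_iff_not_dvd).2 hj
    have := congrArg (aeval z) hab
    simp [hz, h0] at this
  let v' : Matrix (Fin 1) (Fin w) ℝ[X] := fun _ => v
  have hv' : q ^ k • v' = fun _ => σ.T i := by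
    funext _
    exact hv.symm
  have hqk : q ^ k ≠ 0 := pow_ne_zero _ hq.ne_zero
  have hvΦ : v' * σ.Φ = 0 := by
    have h1 : q ^ k • (v' * σ.Φ) = 0 := by
      rw [← Matrix.smul_mul, hv']
      ext1 _ l
      exact congrFun (congrFun σ.T_mul_Φ i) l
    exact (smul_eq_zero.1 h1).resolve_left hqk
  -- This vector is killed by `V(z)`, hence by `R(z)` as `z` is a root of `d`, while `v` takes it to
  -- `v j` at `z` because `v` kills `Φ`. After scaling, `F` solves `R` and `v` sends it to `Re
  -- e^{zt}`.
  let c₀ : Fin w → ℂ := evalAt (1 - σ.Φ * σ.V) z *ᵥ Pi.single j 1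
  have hR : evalAt R z *ᵥ c₀ = 0 := by
    rw [σ.evalAt_eq hzd, ← mulVec_mulVec]
    have : evalAt σ.V z *ᵥ c₀ = 0 := by
      rw [mulVec_mulVec, ← evalAt_mul, Matrix.mul_sub, ← Matrix.mul_assoc, σ.V_mul_Φ,
        Matrix.mul_one, Matrix.one_mul, evalAt_sub, sub_self, zero_mulVec]
    rw [this, mulVec_zero]
  have hvc : evalAt v' z *ᵥ c₀ = fun _ => aeval z (v j) := by
    rw [mulVec_mulVec, ← evalAt_mul, Matrix.mul_sub, ← Matrix.mul_assoc, hvΦ, Matrix.mul_one,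
      Matrix.zero_mul, sub_zero, mulVec_single_one]
    rfl
  let c : Fin w → ℂ := (aeval z (v j))⁻¹ • c₀
  let F : Fin w → SmoothFun := fun j => expRe z (c j)
  have hF : act R F = 0 := by
    rw [act_expRe, mulVec_smul, hR, smul_zero]
    funext i
    simp
  have hvF : act v' F = fun _ => expRe z 1 := by
    rw [act_expRe, mulVec_smul, hvc]
    funext i
    simp [hvj]
  obtain ⟨f₃, hf₃, τ, hτ, h0, hF₃⟩ := h (traj 0) (traj_mem_kerDiff.2 (act_zero R)) (traj F)
    (traj_mem_kerDiff.2 hF)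
  obtain ⟨G, rfl⟩ := exists_traj_of_mem_kerDiff hf₃
  rw [traj_mem_kerDiff] at hf₃
  -- `q ^ k • v` is a row of `T`, a combination of rows of `R`. So along the patched trajectory the
  -- output of `v` solves a scalar equation; it vanishes in the past, hence always, yet after `τ` it
  -- is `Re e^{zt}`.
  have hg : q ^ k • act v' G 0 = 0 := by
    have h1 : q ^ k • act v' G 0 = act σ.T G i := by
      have h2 : ∀ j, σ.T i j = q ^ k * v j := fun j => congrFun hv j
      simp only [act, Finset.smul_sum, h2, mul_smul]
      rfl
    rw [h1, σ.T_eq, act_mul, hf₃, act_zero]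
    rfl
  have hloc : ∀ {t : ℝ} {H : Fin w → SmoothFun} {S : Set ℝ}, S ∈ nhds t →
      (∀ r ∈ S, traj G r = traj H r) → (act v' G 0).1 t = (act v' H 0).1 t := fun hS hH =>
    act_congr _ (fun j => Filter.eventually_of_mem hS fun r hr => congrFun (hH r hr) j) 0
  have hG0 : act v' G 0 = 0 := by
    refine eq_zero_of_smul_eq_zero hqk hg (t₀ := -1) ?_
    refine Filter.eventually_of_mem (Iio_mem_nhds (show (-1 : ℝ) < 0 by norm_num)) fun t ht => ?_
    rw [hloc (Iic_mem_nhds ht) h0, act_zero]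
    rfl
  have hexp : expRe z 1 = 0 := by
    refine eq_zero_of_smul_eq_zero (p := q) hq.ne_zero (t₀ := τ + 1) ?_ ?_
    · rw [smul_expRe, hz, zero_mul, map_zero]
    · refine Filter.eventually_of_mem (Ioi_mem_nhds (lt_add_one τ)) fun t ht => ?_
      have h1 := hloc (Ici_mem_nhds ht) hF₃
      rw [hG0, hvF] at h1
      exact h1.symm
  have h1 := expRe_apply_zero z 1
  rw [hexp] at h1
  exact zero_ne_one h1

end SplitReduction

end

/-! ### Smallest controllable superbehaviors -/

noncomputable section

open SmoothFun Matrix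

namespace LinDiffBehavior

variable {w p m s : ℕ}

/-- The behavior with a given kernel representation. -/
def ofMatrix (R : Matrix (Fin p) (Fin w) ℝ[X]) : LinDiffBehavior w := ⟨kerDiff R, p, R, rfl⟩

lemma isKernelRep_ofMatrix (R : Matrix (Fin p) (Fin w) ℝ[X]) : (ofMatrix R).IsKernelRep R := rfl

lemma inputCard_eq {B : LinDiffBehavior w} {R : Matrix (Fin p) (Fin w) ℝ[X]}
    (hR : B.IsKernelRep R) : B.inputCard = w - R.rank := by
  have h : kerDiff B.exists_ker.choose_spec.choose = kerDiff R :=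
    B.exists_ker.choose_spec.choose_spec.symm.trans hR
  rw [inputCard, le_antisymm (rank_le_of_kerDiff_subset h.ge) (rank_le_of_kerDiff_subset h.le)]

/-- When `T = 0`, each of `R` and `V` is a left multiple of the other, so their kernels agree and
the right inverse of `V` patches. -/
lemma controllable_iff {B : LinDiffBehavior w} {R : Matrix (Fin p) (Fin w) ℝ[X]}
    (hR : B.IsKernelRep R) (σ : SplitReduction R s) : B.Controllable ↔ σ.T = 0 := by
  rw [Controllable, show B.carrier = kerDiff R from hR]
  refine ⟨σ.T_eq_zero_of_patch, fun h => ?_⟩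
  have h1 : kerDiff R = kerDiff σ.V := by
    refine σ.kerDiff_subset.antisymm ?_
    conv_rhs => rw [σ.T_eq_zero_iff.1 h]
    exact kerDiff_subset_kerDiff_mul _ _
  rw [h1]
  exact fun f₁ h₁ f₂ h₂ => exists_patch_of_mul_eq_one σ.V_mul_Φ h₁ h₂

lemma controllable_ofMatrix {V : Matrix (Fin s) (Fin w) ℝ[X]} {Φ : Matrix (Fin w) (Fin s) ℝ[X]}
    (h : V * Φ = 1) : (ofMatrix V).Controllable :=
  fun _ h₁ _ h₂ => exists_patch_of_mul_eq_one h h₁ h₂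

lemma inputCard_ofMatrix {V : Matrix (Fin s) (Fin w) ℝ[X]} {Φ : Matrix (Fin w) (Fin s) ℝ[X]}
    (h : V * Φ = 1) : (ofMatrix V).inputCard = w - s := by
  rw [inputCard_eq (isKernelRep_ofMatrix V), le_antisymm (rank_le_height V)
    (le_rank_of_mul_mul_eq_one (L := 1) (F := Φ) (by rw [Matrix.one_mul, h]))]

/-- Nested controllable behaviors with equal input cardinalities coincide. -/
theorem eq_of_subset_of_controllable {B B' : LinDiffBehavior w} (hsub : B.carrier ⊆ B'.carrier)
    (hB : B.Controllable) (hB' : B'.Controllable) (hcard : B.inputCard = B'.inputCard) :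
    B = B' := by
  obtain ⟨p, R, hR⟩ := B.exists_ker
  obtain ⟨p', R', hR'⟩ := B'.exists_ker
  obtain ⟨s, ⟨σ⟩⟩ := exists_splitReduction R
  obtain ⟨s', ⟨σ'⟩⟩ := exists_splitReduction R'
  have hT := (controllable_iff hR σ).1 hB
  have hT' := (controllable_iff hR' σ').1 hB'
  rw [inputCard_eq hR, inputCard_eq hR', σ.rank_of_T_eq_zero hT, σ'.rank_of_T_eq_zero hT'] at hcard
  -- Both ranks are at most `w`, so equality of the truncated differences gives `s = s'`.
  have hs := σ.rank_V ▸ rank_le_width σ.V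
  have hs' := σ'.rank_V ▸ rank_le_width σ'.V
  have hsub' : kerDiff R ⊆ kerDiff R' := by rw [← hR, ← hR']; exact hsub
  have key : R = R * σ'.Φ * σ'.V := by
    refine eq_mul_mul_of_evalAt σ'.V_mul_Φ fun z c hc => ?_
    refine ker_le_of_rank_eq (mulVec_evalAt_eq_zero_of_kerDiff_subset hsub' z) ?_ c ?_
    · rw [σ.rank_evalAt_of_T_eq_zero hT, σ'.rank_evalAt_of_T_eq_zero hT']
      omega
    · rw [σ'.T_eq_zero_iff.1 hT', evalAt_mul, ← mulVec_mulVec, hc, mulVec_zero]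
  refine LinDiffBehavior.ext (hsub.antisymm ?_)
  rw [hR, hR', key]
  exact σ'.kerDiff_subset.trans (kerDiff_subset_kerDiff_mul _ _)

variable {B₁ B₂ : LinDiffBehavior w} {R : Matrix (Fin p) (Fin w) ℝ[X]}

lemma isControllableSuper_ofMatrix (hR : B₁.IsKernelRep R) {V : Matrix (Fin s) (Fin w) ℝ[X]}
    {Φ : Matrix (Fin w) (Fin s) ℝ[X]} (h : V * Φ = 1) {L : Matrix (Fin s) (Fin p) ℝ[X]}
    (hL : V = L * R) : B₁.IsControllableSuper (ofMatrix V) := by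
  refine ⟨?_, controllable_ofMatrix h⟩
  rw [hR, hL]
  exact kerDiff_subset_kerDiff_mul _ _

/-- A controllable superbehavior has constant rank, which at a root of `d` is bounded by the rank
`s` of `R(z)`. -/
lemma le_inputCard_of_isControllableSuper (hR : B₁.IsKernelRep R) (σ : SplitReduction R s)
    (h : B₁.IsControllableSuper B₂) : w - s ≤ B₂.inputCard := by
  obtain ⟨p', R', hR'⟩ := B₂.exists_ker
  obtain ⟨s', ⟨σ'⟩⟩ := exists_splitReduction R'
  have hT' := (controllable_iff hR' σ').1 h.2
  obtain ⟨z, hz⟩ := σ.exists_root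
  have hsub : kerDiff R ⊆ kerDiff R' := by rw [← hR, ← hR']; exact h.1
  have h1 := rank_evalAt_le_of_kerDiff_subset hsub z
  rw [σ.rank_evalAt_eq hz, σ'.rank_evalAt_of_T_eq_zero hT'] at h1
  rw [inputCard_eq hR', σ'.rank_of_T_eq_zero hT']
  omega

lemma isSmallestControllableSuper_iff (hR : B₁.IsKernelRep R) (σ : SplitReduction R s) :
    B₁.IsSmallestControllableSuper B₂ ↔ B₁.IsControllableSuper B₂ ∧ B₂.inputCard = w - s := by
  refine ⟨fun h => ⟨h.1, le_antisymm ?_ (le_inputCard_of_isControllableSuper hR σ h.1)⟩,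
    fun h => ⟨h.1, fun B hB => h.2.trans_le (le_inputCard_of_isControllableSuper hR σ hB)⟩⟩
  rw [← inputCard_ofMatrix σ.V_mul_Φ]
  exact h.2 _ (isControllableSuper_ofMatrix hR σ.V_mul_Φ σ.V_eq)

lemma isSmallestControllableSuper_ofMatrix (hR : B₁.IsKernelRep R) (σ : SplitReduction R s)
    {V : Matrix (Fin s) (Fin w) ℝ[X]} {Φ : Matrix (Fin w) (Fin s) ℝ[X]} (h : V * Φ = 1)
    {L : Matrix (Fin s) (Fin p) ℝ[X]} (hL : V = L * R) :
    B₁.IsSmallestControllableSuper (ofMatrix V) :=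
  (isSmallestControllableSuper_iff hR σ).2
    ⟨isControllableSuper_ofMatrix hR h hL, inputCard_ofMatrix h⟩

lemma isSmallestControllableSuper_iff_eq (hR : B₁.IsKernelRep R) (σ : SplitReduction R s)
    (hc : B₁.Controllable) : B₁.IsSmallestControllableSuper B₂ ↔ B₂ = B₁ := by
  have hcard : B₁.inputCard = w - s := by
    rw [inputCard_eq hR, σ.rank_of_T_eq_zero ((controllable_iff hR σ).1 hc)]
  rw [isSmallestControllableSuper_iff hR σ]
  refine ⟨fun h => (eq_of_subset_of_controllable h.1.1 hc h.1.2 (hcard.trans h.2.symm)).symm, ?_⟩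
  rintro rfl
  exact ⟨⟨subset_rfl, hc⟩, hcard⟩

/-- If some value of the kernel representation vanishes, the only smallest controllable
superbehavior consists of all smooth trajectories. -/
lemma eq_of_evalAt_eq_zero (hR : B₁.IsKernelRep R) (σ : SplitReduction R s) {z : ℂ}
    (hz : evalAt R z = 0) (h : B₁.IsSmallestControllableSuper B₂) : B₂ = ofMatrix σ.V := by
  have h' := (isSmallestControllableSuper_iff hR σ).1 h
  have hs := σ.le_rank_evalAt z
  rw [hz, rank_zero, Nat.le_zero] at hs
  subst hs
  refine eq_of_subset_of_controllable (fun f hf => ?_) h'.1.2 (controllable_ofMatrix σ.V_mul_Φ)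
    (h'.2.trans (inputCard_ofMatrix σ.V_mul_Φ).symm)
  obtain ⟨p', R', hR'⟩ := B₂.exists_ker
  rw [hR'] at hf
  exact ⟨hf.1, fun i => i.elim0⟩

/-- A nonzero complementary part and a nonempty unimodular part give two different smallest
controllable superbehaviors. -/
lemma exists_ne_of_T_ne_zero (hR : B₁.IsKernelRep R) (σ : SplitReduction R s) (hT : σ.T ≠ 0)
    (hs : 0 < s) : ∃ B, B₁.IsSmallestControllableSuper B ∧ B ≠ ofMatrix σ.V := by
  obtain ⟨i, hi⟩ := Function.ne_iff.1 hT
  -- `E * T` carries a nonzero row of `T` into the first row of `V`. As `T * Φ = 0`, the same `Φ`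
  -- stays a right inverse.
  let E : Matrix (Fin s) (Fin p) ℝ[X] := Matrix.single ⟨0, hs⟩ i 1
  have hV : (σ.V + E * σ.T) * σ.Φ = 1 := by
    rw [Matrix.add_mul, Matrix.mul_assoc, σ.T_mul_Φ, Matrix.mul_zero, add_zero, σ.V_mul_Φ]
  have hL : σ.V + E * σ.T = (σ.L + E * (1 - R * σ.Φ * σ.L)) * R := by
    rw [Matrix.add_mul, ← σ.V_eq, Matrix.mul_assoc E, ← σ.T_eq]
  refine ⟨ofMatrix (σ.V + E * σ.T), isSmallestControllableSuper_ofMatrix hR σ hV hL, fun h => ?_⟩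
  have hker : kerDiff (σ.V + E * σ.T) = kerDiff σ.V := congrArg carrier h
  -- Equal kernels would give `V + E * T = (V + E * T) * Φ * V = V`, so the chosen row of `T` would
  -- vanish.
  have h1 := eq_mul_mul_of_evalAt σ.V_mul_Φ
    fun z => mulVec_evalAt_eq_zero_of_kerDiff_subset hker.ge z
  rw [hV, Matrix.one_mul, add_eq_left] at h1
  refine hi ?_
  funext j
  have h2 := congrFun (congrFun h1 ⟨0, hs⟩) j
  simpa [E] using h2

lemma rankDrop_eq (σ : SplitReduction R s) : rankDrop R = R.rank - s := by
  obtain ⟨z, hz⟩ := σ.exists_root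
  obtain ⟨hle, z', hz'⟩ := rank_evalAt_le_and_exists_eq R
  have h1 : (⨆ z : ℂ, (evalAt R z).rank) = R.rank :=
    le_antisymm (ciSup_le hle)
      (hz' ▸ le_ciSup (f := fun z => (evalAt R z).rank) ⟨R.rank, by rintro _ ⟨z, rfl⟩; exact hle z⟩ z')
  have h2 : (⨅ z : ℂ, (evalAt R z).rank) = s :=
    le_antisymm ((ciInf_le (OrderBot.bddBelow _) z).trans_eq (σ.rank_evalAt_eq hz))
      (le_ciInf σ.le_rank_evalAt)
  rw [rankDrop, h1, h2]

end LinDiffBehavior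

end

open LinDiffBehavior

theorem mainTheorem3 {w p : ℕ} (B₁ : LinDiffBehavior w)
    (R₁ : Matrix (Fin p) (Fin w) ℝ[X]) (hR₁ : B₁.IsKernelRep R₁) :
    (∃ B₂ : LinDiffBehavior w, B₁.IsSmallestControllableSuper B₂) ∧
    ((∃! B₂ : LinDiffBehavior w, B₁.IsSmallestControllableSuper B₂) ↔
      (B₁.Controllable ∨ ∃ z : ℂ, evalAt R₁ z = 0)) ∧
    (B₁.Controllable →
      ∀ B₂ : LinDiffBehavior w, B₁.IsSmallestControllableSuper B₂ ↔ B₂ = B₁) ∧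
    (¬ B₁.Controllable →
      ∀ B₂ : LinDiffBehavior w, B₁.IsSmallestControllableSuper B₂ →
        B₁.inputCard < B₂.inputCard ∧ B₂.inputCard = B₁.inputCard + rankDrop R₁) := by
  obtain ⟨s, ⟨σ⟩⟩ := exists_splitReduction R₁
  have hV := isSmallestControllableSuper_ofMatrix hR₁ σ σ.V_mul_Φ σ.V_eq
  refine ⟨⟨_, hV⟩, ⟨fun h => ?_, ?_⟩, fun hc B₂ => isSmallestControllableSuper_iff_eq hR₁ σ hc,
    fun hc B₂ h => ?_⟩
  · by_contra! hne
    rcases Nat.eq_zero_or_pos s with rfl | hs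
    -- With no rows in `V`, the factorization of `R₁(z)` through `V(z)` at a root of `d` says `R₁(z)
    -- = 0`.
    · obtain ⟨z, hz⟩ := σ.exists_root
      refine hne.2 z ?_
      rw [σ.evalAt_eq hz]
      ext i j
      simp [Matrix.mul_apply]
    · have hT : σ.T ≠ 0 := fun hT => hne.1 ((controllable_iff hR₁ σ).2 hT)
      obtain ⟨B, hB, hBV⟩ := exists_ne_of_T_ne_zero hR₁ σ hT hs
      exact hBV (h.unique hB hV)
  · rintro (hc | ⟨z, hz⟩)
    · exact ⟨B₁, (isSmallestControllableSuper_iff_eq hR₁ σ hc).2 rfl,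
        fun B hB => (isSmallestControllableSuper_iff_eq hR₁ σ hc).1 hB⟩
    · exact ⟨_, hV, fun B hB => eq_of_evalAt_eq_zero hR₁ σ hz hB⟩
  · have hT : σ.T ≠ 0 := fun hT => hc ((controllable_iff hR₁ σ).2 hT)
    have h1 := σ.lt_rank hT
    have h2 := Matrix.rank_le_width R₁
    rw [((isSmallestControllableSuper_iff hR₁ σ).1 h).2, inputCard_eq hR₁, rankDrop_eq σ]
    omega
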